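/- Let $\mathbb{R}^n_\infty$ be $\mathbb{R}^n$ with the maximum metric $d_\infty(p,q)=\max_i|p_i-q_i|$. A plane in $\mathbb{R}^3_\infty$ is the solution set of an equation $ax+by+cz=d$ with $a,b,c,d\in\mathbb{R}$ and $a,b,c$ not all zero, with the restricted metric. Two metric spaces are isometric if there is a surjective isometry between them. Let $P$ be the plane $ax+by+cz=d$. (i) If $|a|,|b|,|c|$ are not the side lengths of a non-degenerate Euclidean triangle, then $P$ is isometric to $\mathbb{R}^2_\infty$. All such planes form exactly one isometry class: a plane $a'x+b'y+c'z=d'$ is isometric to $P$ if and only if $|a'|,|b'|,|c'|$ are not the side lengths of a non-degenerate triangle. (ii) If $|a|,|b|,|c|$ are the side lengths of a non-degenerate Euclidean triangle, then a plane $Q$ in $\mathbb{R}^3_\infty$ is isometric to $P$ if and only if $Q$ has an equation $aw_1+bw_2+cw_3=D$, where $D\in\mathbb{R}$ and $w_1,w_2,w_3$ are the coordinates $x,y,z$ in some order, each multiplied by $1$ or $-1$. Moreover, there is a bijection from the set of isometry classes of the planes in (ii) to the set of similarity classes of non-degenerate triangles in the Euclidean plane, which sends the class of the plane $ax+by+cz=d$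 to the class of the triangles with side lengths $|a|,|b|,|c|$. -/

import Mathlib

/-!
`ℝⁿ` with the maximum metric `d_∞` is the function type `Fin n → ℝ`, whose metric in Mathlib is
`dist p q = max |p i - q i|`.  A subset carries the restricted metric, and two metric spaces `X`,
`Y` are isometric if `Nonempty (X ≃ᵢ Y)`, i.e. if there is a surjective isometry `X → Y`.
-/

namespace MaxMetric

/-- The solution set of `a x + b y + c z = d` in `ℝ³_∞`
(a plane when `a`, `b`, `c` are not all zero). -/
def plane (a b c d : ℝ) : Set (Fin 3 → ℝ) :=
  {p | a * p 0 + b * p 1 + c * p 2 = d}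

/-- A subset of `ℝ³` is a plane if it is given by an equation `a x + b y + c z = d` in which
`a`, `b`, `c` are not all zero. -/
def IsPlane (P : Set (Fin 3 → ℝ)) : Prop :=
  ∃ a b c d : ℝ, (a ≠ 0 ∨ b ≠ 0 ∨ c ≠ 0) ∧ P = plane a b c d

/-- The functions `w 0`, `w 1`, `w 2` on `ℝ³` are the coordinate functions `x, y, z` in some order,
each with some sign: `{w₁, w₂, w₃} = {±x, ±y, ±z}`. -/
def IsSignedCoords (w : Fin 3 → (Fin 3 → ℝ) → ℝ) : Prop :=
  ∃ (σ : Equiv.Perm (Fin 3)) (ε : Fin 3 → ℝ),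
    (∀ i, ε i = 1 ∨ ε i = -1) ∧ ∀ i p, w i p = ε i * p (σ i)

/-- Non-degenerate triangles (triples of affinely independent points) in the Euclidean plane. -/
abbrev EuclideanTriangle : Type := Affine.Triangle ℝ (EuclideanSpace ℝ (Fin 2))

/-- The edges of `T` opposite to its vertices number `0`, `1`, `2` have lengths `u`, `v`, `w`. -/
def HasSideLengths (T : EuclideanTriangle) (u v w : ℝ) : Prop :=
  dist (T.points 1) (T.points 2) = u ∧ dist (T.points 2) (T.points 0) = v ∧
    dist (T.points 0) (T.points 1) = w

/-- `u`, `v`, `w` are the side lengths of a non-degenerate Euclidean triangle. -/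
def AreTriangleSides (u v w : ℝ) : Prop :=
  ∃ T : EuclideanTriangle, HasSideLengths T u v w

/-- Similarity of triangles; the vertices may be matched in any order. -/
instance triangleSimilarity : Setoid EuclideanTriangle where
  r T T' := ∃ σ : Equiv.Perm (Fin 3), Similar (T.points ∘ σ) T'.points
  iseqv :=
    { refl := fun T => ⟨Equiv.refl _, Similar.refl _⟩
      symm := by
        rintro T T' ⟨σ, h⟩
        refine ⟨σ.symm, ?_⟩
        have h' := (h.index_map σ.symm).symm
        simpa [Function.comp_assoc] using h'
      trans := by
        rintro T T' T'' ⟨σ, h⟩ ⟨τ, k⟩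
        refine ⟨τ.trans σ, ?_⟩
        have h' := (h.index_map τ).trans k
        simpa [Function.comp_assoc] using h' }

/-- The planes `a x + b y + c z = d` in `ℝ³_∞` for which `|a|`, `|b|`, `|c|` are the side lengths of
a non-degenerate triangle (so that `a`, `b`, `c` are automatically nonzero). -/
def TriangularPlane : Type :=
  {P : Set (Fin 3 → ℝ) // ∃ a b c d : ℝ, AreTriangleSides |a| |b| |c| ∧ P = plane a b c d}

/-- The relation of being isometric, on these planes. -/
instance planeIsometry : Setoid TriangularPlane where
  r P Q := Nonempty (P.1 ≃ᵢ Q.1)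
  iseqv :=
    { refl := fun P => ⟨IsometryEquiv.refl _⟩
      symm := fun ⟨e⟩ => ⟨e.symm⟩
      trans := fun ⟨e⟩ ⟨f⟩ => ⟨e.trans f⟩ }

end MaxMetric

namespace MaxMetric

/-! A plane is a translate of its direction `n ⬝ᵥ v = 0`, so by Mazur–Ulam an isometry of planes
gives a linear isometry of directions under the sup norm. If some `|n i|` is at least the sum of the
other two, coordinate `i` never decides the norm, and dropping it gives `ℝ²_∞`
(`nonempty_isometryEquiv_of_dominant`).

Otherwise the unit ball of the direction is a hexagon with edges on `v j = ±1`. A linear isometry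
respects its edges, hence permutes the coordinates up to sign
(`StrictTriangle.exists_coord_comp_eq`), so the normals agree up to a factor, a permutation and
signs (`SignedMultiple`). Conversely, signed permutations and translations are isometries. On
absolute values, `SignedMultiple` says that side lengths are proportional, which is similarity of
triangles (SSS). -/

theorem mem_plane_iff_dotProduct (n : Fin 3 → ℝ) (d : ℝ) (p : Fin 3 → ℝ) :
    p ∈ plane (n 0) (n 1) (n 2) d ↔ n ⬝ᵥ p = d := by
  simp [plane, dotProduct, Fin.sum_univ_three]

/-- The absolute values of the coordinates of `n` satisfy the strict triangle inequalities. -/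
def StrictTriangle (n : Fin 3 → ℝ) : Prop :=
  ∀ i j k : Fin 3, i ≠ j → j ≠ k → i ≠ k → |n i| < |n j| + |n k|

theorem strictTriangle_iff (n : Fin 3 → ℝ) :
    StrictTriangle n ↔ |n 0| < |n 1| + |n 2| ∧ |n 1| < |n 2| + |n 0| ∧ |n 2| < |n 0| + |n 1| := by
  constructor
  · intro h
    exact ⟨h 0 1 2 (by decide) (by decide) (by decide), h 1 2 0 (by decide) (by decide) (by decide),
      h 2 0 1 (by decide) (by decide) (by decide)⟩
  · rintro ⟨h0, h1, h2⟩ i j k hij hjk hik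
    fin_cases i <;> fin_cases j <;> fin_cases k <;> simp_all <;> linarith

/-- The vectors orthogonal to `n`, that is, the direction of the planes with normal vector `n`. -/
def direction (n : Fin 3 → ℝ) : Submodule ℝ (Fin 3 → ℝ) where
  carrier := {v | n ⬝ᵥ v = 0}
  add_mem' := by
    intro u v hu hv
    simp_all [dotProduct_add]
  zero_mem' := by simp
  smul_mem' := by
    intro r v hv
    simp_all [dotProduct_smul]

theorem mem_direction {n v : Fin 3 → ℝ} : v ∈ direction n ↔ n ⬝ᵥ v = 0 := Iff.rfl

theorem exists_third {j k : Fin 3} (h : j ≠ k) :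
    ∃ l, j ≠ l ∧ k ≠ l ∧ ∀ f : Fin 3 → ℝ, ∑ i, f i = f j + f k + f l := by
  fin_cases j <;> fin_cases k <;> simp at h
  · exact ⟨2, by simp, by simp, fun f => by simp [Fin.sum_univ_three]⟩
  · exact ⟨1, by simp, by simp, fun f => by simp [Fin.sum_univ_three]; ring⟩
  · exact ⟨2, by simp, by simp, fun f => by simp [Fin.sum_univ_three]; ring⟩
  · exact ⟨0, by simp, by simp, fun f => by simp [Fin.sum_univ_three]; ring⟩
  · exact ⟨1, by simp, by simp, fun f => by simp [Fin.sum_univ_three]; ring⟩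
  · exact ⟨0, by simp, by simp, fun f => by simp [Fin.sum_univ_three]; ring⟩

/-! ### Edges of the unit ball and linear isometries. -/

theorem StrictTriangle.ne_zero {n : Fin 3 → ℝ} (h : StrictTriangle n) (j : Fin 3) : n j ≠ 0 := by
  intro h0
  obtain ⟨k, hjk⟩ := exists_ne j
  obtain ⟨l, hkl, hjl, -⟩ := exists_third hjk
  have h1 := h k j l hjk hjl hkl
  have h2 := h l j k hjl.symm hjk.symm hkl.symm
  rw [h0, abs_zero] at h1 h2
  linarith

theorem exists_apply_eq {j k : Fin 3} (h : j ≠ k) (x y z : ℝ) :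
    ∃ v : Fin 3 → ℝ, v j = x ∧ v k = y ∧ ∀ l, l ≠ j → l ≠ k → v l = z := by
  refine ⟨fun i => if i = j then x else if i = k then y else z, by simp, ?_, ?_⟩
  · simp [h.symm]
  · intro l h1 h2
    simp [h1, h2]

theorem StrictTriangle.exists_peak {n : Fin 3 → ℝ} (h : StrictTriangle n) (j : Fin 3) :
    ∃ v ∈ direction n, v j = 1 ∧ ∀ k, k ≠ j → |v k| < 1 := by
  obtain ⟨k, hkj⟩ := exists_ne j
  obtain ⟨l, hjl, hkl, hsum⟩ := exists_third hkj.symm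
  have hk : 0 < |n k| := abs_pos.2 (h.ne_zero k)
  have hl : 0 < |n l| := abs_pos.2 (h.ne_zero l)
  have hlt := h j k l hkj.symm hkl hjl
  have hs : 0 < |n k| + |n l| := by positivity
  -- Both other coordinates get the same modulus; `|n k| / n k` is the sign of `n k`. This modulus
  -- is below 1 by the strict inequality.
  obtain ⟨v, hvj, hvk, hvl⟩ := exists_apply_eq hkj.symm 1
    (-(n j / (|n k| + |n l|)) * (|n k| / n k)) (-(n j / (|n k| + |n l|)) * (|n l| / n l))
  have hvl := hvl l hjl.symm hkl.symm
  have hb : |n j| / (|n k| + |n l|) < 1 := (div_lt_one hs).2 hlt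
  refine ⟨v, ?_, hvj, ?_⟩
  · rw [mem_direction, dotProduct, hsum, hvj, hvk, hvl]
    have := h.ne_zero k
    have := h.ne_zero l
    field_simp
    ring
  · have hbk : |v k| < 1 := by
      rw [hvk, abs_mul, abs_neg, abs_div, abs_div, abs_abs, abs_of_pos hs, div_self hk.ne', mul_one]
      exact hb
    have hbl : |v l| < 1 := by
      rw [hvl, abs_mul, abs_neg, abs_div, abs_div, abs_abs, abs_of_pos hs, div_self hl.ne', mul_one]
      exact hb
    intro i hi
    rcases eq_or_ne i k with rfl | hik
    · exact hbk
    · have : i = l := by omega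
      exact this ▸ hbl

/-- Provides the direction `w` of the edge `v j = 1`. -/
theorem StrictTriangle.exists_kernel_vector {n : Fin 3 → ℝ} (h : StrictTriangle n) (j : Fin 3) :
    ∃ w ∈ direction n, w j = 0 ∧ ∀ u ∈ direction n, u j = 0 → ∃ t : ℝ, u = t • w := by
  obtain ⟨k, hkj⟩ := exists_ne j
  obtain ⟨l, hjl, hkl, hsum⟩ := exists_third hkj.symm
  obtain ⟨w, hwj, hwk, hwl⟩ := exists_apply_eq hkj.symm 0 (n l) (-n k)
  have hwl := hwl l hjl.symm hkl.symm
  refine ⟨w, ?_, hwj, ?_⟩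
  · rw [mem_direction, dotProduct, hsum, hwj, hwk, hwl]
    ring
  · intro u hu huj
    rw [mem_direction, dotProduct, hsum, huj] at hu
    have hl0 := h.ne_zero l
    refine ⟨u k / n l, ?_⟩
    ext i
    rcases eq_or_ne i j with rfl | hij
    · simp [huj, hwj]
    rcases eq_or_ne i k with rfl | hik
    · simp [hwk, hl0]
    · have : i = l := by omega
      subst this
      simp only [Pi.smul_apply, smul_eq_mul, hwl]
      field_simp
      linarith

theorem exists_abs_apply_eq_norm (x : Fin 3 → ℝ) : ∃ i, |x i| = ‖x‖ := by
  obtain ⟨i, -, hi⟩ := Finset.exists_mem_eq_sup Finset.univ Finset.univ_nonempty fun i => ‖x i‖₊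
  refine ⟨i, ?_⟩
  rw [Pi.norm_def, hi]
  simp

/-- The peak `v` stays in the unit ball when moved slightly along `±w`, and so does its image. A
coordinate `i` where `L v` has modulus 1 therefore cannot change, so it vanishes on `L w`. Since `v`
and `w` span the direction, this determines coordinate `i` of `L`. -/
theorem StrictTriangle.exists_coord_comp_eq {n n' : Fin 3 → ℝ} (h : StrictTriangle n)
    (L : direction n →ₗᵢ[ℝ] direction n') (j : Fin 3) :
    ∃ (i : Fin 3) (s : ℝ), (s = 1 ∨ s = -1) ∧
      ∀ u : direction n, (L u : Fin 3 → ℝ) i = s * (u : Fin 3 → ℝ) j := by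
  obtain ⟨v, hv, hvj, hvk⟩ := h.exists_peak j
  obtain ⟨w, hw, hwj, hspan⟩ := h.exists_kernel_vector j
  have hsmall : ∀ᶠ t : ℝ in nhds 0, ∀ k, |v k + t * w k| ≤ 1 := by
    rw [Filter.eventually_all]
    intro k
    rcases eq_or_ne k j with rfl | hk
    · simp [hvj, hwj]
    · have hc : Filter.Tendsto (fun t : ℝ => |v k + t * w k|) (nhds 0) (nhds |v k + 0 * w k|) :=
        Continuous.tendsto (by fun_prop) 0
      rw [zero_mul, add_zero] at hc
      filter_upwards [hc.eventually_lt_const (hvk k hk)] with t ht using ht.le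
  obtain ⟨r, hr, hball⟩ := Metric.eventually_nhds_iff.1 hsmall
  set V : direction n := ⟨v, hv⟩
  set W : direction n := ⟨w, hw⟩
  have hbound : ∀ t : ℝ, |t| < r → ∀ i, |(L V : Fin 3 → ℝ) i + t * (L W : Fin 3 → ℝ) i| ≤ 1 := by
    intro t ht i
    have h1 : ‖L (V + t • W)‖ ≤ 1 := by
      rw [L.norm_map, Submodule.coe_norm, pi_norm_le_iff_of_nonneg zero_le_one]
      intro k
      exact hball (by simpa using ht) k
    have h2 := (norm_le_pi_norm (L (V + t • W) : Fin 3 → ℝ) i).trans h1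
    simpa using h2
  have hnorm : ‖(L V : Fin 3 → ℝ)‖ = 1 := by
    rw [← Submodule.coe_norm, L.norm_map, Submodule.coe_norm]
    apply le_antisymm
    · rw [pi_norm_le_iff_of_nonneg zero_le_one]
      intro k
      have := hball (y := 0) (by simpa using hr) k
      simpa using this
    · have := norm_le_pi_norm v j
      simpa [hvj] using this
  obtain ⟨i, hi⟩ := exists_abs_apply_eq_norm (L V : Fin 3 → ℝ)
  rw [hnorm] at hi
  have hi' := (abs_eq zero_le_one).1 hi
  have hLW : (L W : Fin 3 → ℝ) i = 0 := by
    have h1 := abs_le.1 (hbound (r / 2) (by rw [abs_of_pos] <;> linarith) i)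
    have h2 := abs_le.1 (hbound (-(r / 2)) (by rw [abs_neg, abs_of_pos] <;> linarith) i)
    have h3 : r / 2 * (L W : Fin 3 → ℝ) i = 0 := by
      rcases hi' with hi' | hi' <;> rw [hi'] at h1 h2 <;> linarith
    exact (mul_eq_zero.1 h3).resolve_left (by linarith)
  refine ⟨i, (L V : Fin 3 → ℝ) i, hi', fun u => ?_⟩
  obtain ⟨t, ht⟩ := hspan (u - (u : Fin 3 → ℝ) j • v)
    ((direction n).sub_mem u.2 ((direction n).smul_mem _ hv)) (by simp [hvj])
  have hu : u = (u : Fin 3 → ℝ) j • V + t • W := by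
    ext1
    simp only [Submodule.coe_add, Submodule.coe_smul, V, W, ← ht]
    abel
  conv_lhs => rw [hu]
  simp [hLW, mul_comm]

theorem eq_smul_of_direction_le {n m : Fin 3 → ℝ} (hn : n ≠ 0)
    (h : ∀ v ∈ direction n, m ⬝ᵥ v = 0) : ∃ r : ℝ, m = r • n := by
  obtain ⟨i, hi⟩ := Function.ne_iff.1 hn
  rw [Pi.zero_apply] at hi
  refine ⟨m i / n i, ?_⟩
  ext k
  have := h (Pi.single k (n i) - Pi.single i (n k)) (by
    rw [mem_direction]; simp [dotProduct_sub, mul_comm])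
  simp [dotProduct_sub] at this
  simp only [Pi.smul_apply, smul_eq_mul]
  field_simp
  linarith

/-- Up to a nonzero factor, `n'` arises from `n` by permuting coordinates and changing signs. -/
def SignedMultiple (n n' : Fin 3 → ℝ) : Prop :=
  ∃ (τ : Equiv.Perm (Fin 3)) (s : Fin 3 → ℝ) (r : ℝ), (∀ j, s j = 1 ∨ s j = -1) ∧ r ≠ 0 ∧
    ∀ j, n' (τ j) = r * (s j * n j)

/-- Two coordinates with the same image index would have equal modulus everywhere, which a peak
refutes; so `τ` is a permutation. Pulling `n'` back along `L` gives a functional that kills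
`direction n`, hence a multiple of `n`. -/
theorem StrictTriangle.signedMultiple_of_linearIsometry {n n' : Fin 3 → ℝ} (h : StrictTriangle n)
    (hn' : n' ≠ 0) (L : direction n →ₗᵢ[ℝ] direction n') : SignedMultiple n n' := by
  choose τ s hs hL using h.exists_coord_comp_eq L
  have hinj : Function.Injective τ := by
    intro j k hjk
    by_contra hne
    obtain ⟨v, hv, hvj, hvk⟩ := h.exists_peak j
    have h1 := hL j ⟨v, hv⟩
    have h2 := hL k ⟨v, hv⟩
    have h3 := hvk k (Ne.symm hne)
    rw [hjk, h2] at h1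
    have h4 : |s k * v k| = |s j * v j| := congrArg _ h1
    have hone : ∀ j, |s j| = 1 := fun j => (abs_eq zero_le_one).2 (hs j)
    rw [hvj, abs_mul, abs_mul, hone, hone, abs_one] at h4
    linarith
  have hbij : Function.Bijective τ := Finite.injective_iff_bijective.1 hinj
  have hss : ∀ j, s j * s j = 1 := fun j => by rcases hs j with h | h <;> rw [h] <;> norm_num
  obtain ⟨r, hr⟩ := eq_smul_of_direction_le (n := n) (m := fun j => n' (τ j) * s j)
    (fun h0 => h.ne_zero 0 (congrFun h0 0)) (by
      intro v hv
      have h1 := mem_direction.1 (L ⟨v, hv⟩).2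
      rw [dotProduct, ← hbij.sum_comp] at h1
      rw [dotProduct, ← h1]
      refine Finset.sum_congr rfl fun j _ => ?_
      rw [hL]
      ring)
  have hval : ∀ j, n' (τ j) = r * (s j * n j) := fun j => by
    have := congrFun hr j
    simp only [Pi.smul_apply, smul_eq_mul] at this
    calc n' (τ j) = n' (τ j) * s j * s j := by rw [mul_assoc, hss, mul_one]
      _ = r * (s j * n j) := by rw [this]; ring
  refine ⟨Equiv.ofBijective τ hbij, s, r, hs, ?_, hval⟩
  rintro rfl
  apply hn'
  ext i
  obtain ⟨j, rfl⟩ := hbij.2 i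
  simp [hval]

/-! ### Isometries between planes. -/

theorem exists_dotProduct_eq {n : Fin 3 → ℝ} (hn : n ≠ 0) (d : ℝ) : ∃ p, n ⬝ᵥ p = d := by
  obtain ⟨i, hi⟩ := Function.ne_iff.1 hn
  rw [Pi.zero_apply] at hi
  exact ⟨Pi.single i (d / n i), by simp [mul_div_cancel₀ _ hi]⟩

/-- A plane is a translate of its direction. -/
theorem exists_isometryEquiv_direction {n : Fin 3 → ℝ} (hn : n ≠ 0) (d : ℝ) :
    Nonempty (direction n ≃ᵢ {p | n ⬝ᵥ p = d}) := by
  obtain ⟨q, hq⟩ := exists_dotProduct_eq hn d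
  exact ⟨⟨⟨fun v => ⟨v + q, by simp [dotProduct_add, mem_direction.1 v.2, hq]⟩,
    fun p => ⟨p - q, by
      have := p.2
      rw [Set.mem_ofPred_eq] at this
      simp [mem_direction, dotProduct_sub, this, hq]⟩,
    fun v => by simp, fun p => by simp⟩, Isometry.of_dist_eq fun u v => by simp [Subtype.dist_eq]⟩⟩

theorem StrictTriangle.signedMultiple {n n' : Fin 3 → ℝ} (h : StrictTriangle n) (hn' : n' ≠ 0)
    {d d' : ℝ} (e : {p | n ⬝ᵥ p = d} ≃ᵢ {p | n' ⬝ᵥ p = d'}) : SignedMultiple n n' := by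
  obtain ⟨f⟩ := exists_isometryEquiv_direction (fun h0 => h.ne_zero 0 (congrFun h0 0)) d
  obtain ⟨g⟩ := exists_isometryEquiv_direction hn' d'
  -- Mazur–Ulam: subtracting the image of 0 makes the isometry of directions linear.
  exact h.signedMultiple_of_linearIsometry hn'
    ((f.trans e).trans g.symm).toRealLinearIsometryEquiv.toLinearIsometry

/-- This separates the class in (i) from the planes in (ii). -/
theorem SignedMultiple.strictTriangle {n n' : Fin 3 → ℝ} (hs : SignedMultiple n n')
    (h : StrictTriangle n) : StrictTriangle n' := by
  obtain ⟨τ, s, r, hs, hr, hval⟩ := hs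
  have habs : ∀ j, |n' (τ j)| = |r| * |n j| := fun j => by
    rw [hval, abs_mul, abs_mul, (abs_eq zero_le_one).2 (hs j), one_mul]
  intro i j k hij hjk hik
  obtain ⟨i, rfl⟩ := τ.surjective i
  obtain ⟨j, rfl⟩ := τ.surjective j
  obtain ⟨k, rfl⟩ := τ.surjective k
  rw [habs, habs, habs, ← mul_add]
  exact mul_lt_mul_of_pos_left (h i j k (by simpa using hij) (by simpa using hjk)
    (by simpa using hik)) (abs_pos.2 hr)

theorem SignedMultiple.exists_signedCoords {n n' : Fin 3 → ℝ} (hs : SignedMultiple n n') (d' : ℝ) :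
    ∃ (w : Fin 3 → (Fin 3 → ℝ) → ℝ) (D : ℝ), IsSignedCoords w ∧
      {p | n' ⬝ᵥ p = d'} = {p | n 0 * w 0 p + n 1 * w 1 p + n 2 * w 2 p = D} := by
  obtain ⟨τ, s, r, hs, hr, hval⟩ := hs
  refine ⟨fun j p => s j * p (τ j), d' / r, ⟨τ, s, hs, fun _ _ => rfl⟩, ?_⟩
  ext p
  have : n' ⬝ᵥ p = r * ∑ j, n j * (s j * p (τ j)) := by
    rw [dotProduct, ← Equiv.sum_comp τ, Finset.mul_sum]
    refine Finset.sum_congr rfl fun j _ => ?_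
    rw [hval]
    ring
  rw [Set.mem_ofPred_eq, Set.mem_ofPred_eq, this, Fin.sum_univ_three, eq_div_iff hr, mul_comm]

theorem IsSignedCoords.exists_isometryEquiv {w : Fin 3 → (Fin 3 → ℝ) → ℝ} (hw : IsSignedCoords w) :
    ∃ e : (Fin 3 → ℝ) ≃ᵢ (Fin 3 → ℝ), ∀ p i, e p i = w i p := by
  obtain ⟨σ, ε, hε, hw⟩ := hw
  have hss : ∀ j, ε j * ε j = 1 := fun j => by rcases hε j with h | h <;> rw [h] <;> norm_num
  refine ⟨⟨⟨fun p i => ε i * p (σ i), fun q i => ε (σ.symm i) * q (σ.symm i), fun p => ?_,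
    fun q => ?_⟩, Isometry.of_dist_eq fun p q => ?_⟩, fun p i => (hw i p).symm⟩
  · ext i
    simp [← mul_assoc, hss]
  · ext i
    simp [← mul_assoc, hss]
  · simp only [dist_pi_def]
    congr 1
    refine (Finset.sup_congr rfl fun i _ => ?_).trans
      ((Finset.sup_map Finset.univ σ.toEmbedding fun i => nndist (p i) (q i)).symm.trans (by simp))
    have : |ε i| = 1 := (abs_eq zero_le_one).2 (hε i)
    ext
    simp [Real.dist_eq, ← mul_sub, abs_mul, this]

theorem nonempty_isometryEquiv_of_signedCoords {n : Fin 3 → ℝ} (hn : n ≠ 0) (d D : ℝ)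
    {w : Fin 3 → (Fin 3 → ℝ) → ℝ} (hw : IsSignedCoords w) :
    Nonempty ({p | n ⬝ᵥ p = d} ≃ᵢ {p | n 0 * w 0 p + n 1 * w 1 p + n 2 * w 2 p = D}) := by
  obtain ⟨e, he⟩ := hw.exists_isometryEquiv
  obtain ⟨f⟩ := exists_isometryEquiv_direction hn d
  obtain ⟨g⟩ := exists_isometryEquiv_direction hn D
  have hmem : ∀ p, n 0 * w 0 p + n 1 * w 1 p + n 2 * w 2 p = D ↔ n ⬝ᵥ e p = D := fun p => by
    simp [dotProduct, Fin.sum_univ_three, he]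
  exact ⟨(f.symm.trans g).trans
    (⟨e.toEquiv.subtypeEquiv hmem, Isometry.of_dist_eq fun p q => e.dist_eq p q⟩ :
      {p | n 0 * w 0 p + n 1 * w 1 p + n 2 * w 2 p = D} ≃ᵢ {p | n ⬝ᵥ p = D}).symm⟩

theorem SignedMultiple.nonempty_isometryEquiv {n n' : Fin 3 → ℝ} (hs : SignedMultiple n n')
    (hn : n ≠ 0) (d d' : ℝ) : Nonempty ({p | n ⬝ᵥ p = d} ≃ᵢ {p | n' ⬝ᵥ p = d'}) := by
  obtain ⟨w, D, hw, hD⟩ := hs.exists_signedCoords d'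
  rw [hD]
  exact nonempty_isometryEquiv_of_signedCoords hn d D hw

/-- If one coefficient dominates, then forgetting its coordinate is an isometry onto `ℝ²_∞`. -/
theorem nonempty_isometryEquiv_of_dominant {n : Fin 3 → ℝ} (hn : n ≠ 0) (d : ℝ)
    (h : ¬ StrictTriangle n) : Nonempty ({p | n ⬝ᵥ p = d} ≃ᵢ (Fin 2 → ℝ)) := by
  simp only [StrictTriangle, not_forall, not_lt] at h
  obtain ⟨i, j, k, hij, hjk, hik, hle⟩ := h
  have hall : ∀ l, l = i ∨ l = j ∨ l = k := by omega
  have hi : n i ≠ 0 := by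
    intro h0
    rw [h0, abs_zero] at hle
    apply hn
    ext l
    have := abs_nonneg (n j)
    have := abs_nonneg (n k)
    rcases hall l with rfl | rfl | rfl
    · exact h0
    · exact abs_eq_zero.1 (by linarith)
    · exact abs_eq_zero.1 (by linarith)
  have hsum : ∀ p, n ⬝ᵥ p = n i * p i + n j * p j + n k * p k := by
    intro p
    obtain ⟨l, hil, hjl, hl⟩ := exists_third hij
    rw [show k = l by omega, dotProduct, hl]
  let g : (Fin 2 → ℝ) → Fin 3 → ℝ := fun q l =>
    if l = i then (d - n j * q 0 - n k * q 1) / n i else if l = j then q 0 else q 1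
  have gi : ∀ q, g q i = (d - n j * q 0 - n k * q 1) / n i := fun q => by simp [g]
  have gj : ∀ q, g q j = q 0 := fun q => by simp [g, hij.symm]
  have gk : ∀ q, g q k = q 1 := fun q => by simp [g, hik.symm, hjk.symm]
  refine ⟨⟨⟨fun p => ![p.1 j, p.1 k], fun q => ⟨g q, ?_⟩, fun p => ?_, fun q => ?_⟩,
    Isometry.of_dist_eq fun p q => ?_⟩⟩
  · rw [Set.mem_ofPred_eq, hsum, gi, gj, gk]
    field_simp
    ring
  · have hp := p.2
    rw [Set.mem_ofPred_eq, hsum] at hp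
    ext l
    rcases hall l with rfl | rfl | rfl
    · simp only [gi]
      simp
      field_simp
      linarith
    · simp [gj]
    · simp [gk]
  · ext l
    fin_cases l
    · simp [gj]
    · simp [gk]
  · have hp := p.2
    have hq := q.2
    rw [Set.mem_ofPred_eq, hsum] at hp hq
    rw [Subtype.dist_eq]
    apply le_antisymm
    · rw [dist_pi_le_iff dist_nonneg]
      intro l
      fin_cases l
      · exact dist_le_pi_dist p.1 q.1 j
      · exact dist_le_pi_dist p.1 q.1 k
    · set M := dist (![p.1 j, p.1 k] : Fin 2 → ℝ) ![q.1 j, q.1 k]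
      have hj : |p.1 j - q.1 j| ≤ M :=
        dist_le_pi_dist (![p.1 j, p.1 k] : Fin 2 → ℝ) ![q.1 j, q.1 k] 0
      have hk : |p.1 k - q.1 k| ≤ M :=
        dist_le_pi_dist (![p.1 j, p.1 k] : Fin 2 → ℝ) ![q.1 j, q.1 k] 1
      have hM0 : 0 ≤ M := dist_nonneg
      refine (dist_pi_le_iff hM0).2 fun l => ?_
      rcases hall l with rfl | rfl | rfl
      -- The difference `p - q` lies in the direction, so the dominant coefficient bounds this
      -- coordinate by the other two.
      · have h1 : n l * (p.1 l - q.1 l) = -(n j * (p.1 j - q.1 j) + n k * (p.1 k - q.1 k)) := by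
          linarith
        refine le_of_mul_le_mul_left ?_ (abs_pos.2 hi)
        rw [Real.dist_eq, ← abs_mul, h1, abs_neg]
        calc |n j * (p.1 j - q.1 j) + n k * (p.1 k - q.1 k)|
            ≤ |n j| * |p.1 j - q.1 j| + |n k| * |p.1 k - q.1 k| := by
              rw [← abs_mul, ← abs_mul]; exact abs_add_le _ _
          _ ≤ |n j| * M + |n k| * M := by gcongr
          _ = (|n j| + |n k|) * M := by ring
          _ ≤ |n l| * M := by gcongr
      · exact hj
      · exact hk

/-! ### Side lengths and similarity of Euclidean triangles. -/

/-- The length of the edge of `T` opposite to the vertex number `i`. -/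
noncomputable def sideLength (T : EuclideanTriangle) (i : Fin 3) : ℝ :=
  dist (T.points (i + 1)) (T.points (i + 2))

theorem hasSideLengths_iff (T : EuclideanTriangle) (m : Fin 3 → ℝ) :
    HasSideLengths T (m 0) (m 1) (m 2) ↔ sideLength T = m := by
  rw [funext_iff, Fin.forall_fin_succ, Fin.forall_fin_two]
  rfl

theorem sideLength_pos (T : EuclideanTriangle) (i : Fin 3) : 0 < sideLength T i :=
  dist_pos.2 fun h => by simpa using T.independent.injective h

theorem areTriangleSides_iff (n : Fin 3 → ℝ) :
    AreTriangleSides |n 0| |n 1| |n 2| ↔ StrictTriangle n := by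
  rw [strictTriangle_iff]
  constructor
  · rintro ⟨T, h0, h1, h2⟩
    have hT := affineIndependent_iff_not_collinear_set.1
      (show AffineIndependent ℝ ![T.points 0, T.points 1, T.points 2] by
        convert T.independent using 1
        ext i
        fin_cases i <;> rfl)
    have key : ∀ x y z : Fin 3, (({T.points x, T.points y, T.points z} : Set _) =
        {T.points 0, T.points 1, T.points 2}) →
        dist (T.points x) (T.points z) < dist (T.points x) (T.points y) +
          dist (T.points y) (T.points z) := by
      intro x y z hxyz
      -- By strict convexity, equality would make the vertices collinear.
      refine lt_of_le_of_ne (dist_triangle _ _ _) fun h => hT ?_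
      rw [← hxyz]
      exact (dist_add_dist_eq_iff.1 h.symm).collinear
    have k0 := key 1 0 2 (by grind)
    have k1 := key 2 1 0 (by grind)
    have k2 := key 0 2 1 (by grind)
    rw [← h0, ← h1, ← h2]
    rw [dist_comm (T.points 1) (T.points 0), dist_comm (T.points 0) (T.points 2)] at k0
    rw [dist_comm (T.points 2) (T.points 1), dist_comm (T.points 1) (T.points 0)] at k1
    rw [dist_comm (T.points 0) (T.points 2), dist_comm (T.points 2) (T.points 1)] at k2
    refine ⟨?_, ?_, ?_⟩ <;> linarith
  · generalize |n 0| = u, |n 1| = v, |n 2| = w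
    rintro ⟨hu, hv, hw⟩
    have hw0 : 0 < w := by linarith
    -- The law of cosines gives the foot of the altitude from `C` when `A` is the origin and `B =
    -- (w, 0)`.
    set x := (v ^ 2 + w ^ 2 - u ^ 2) / (2 * w) with hx
    have hxw : 2 * w * x = v ^ 2 + w ^ 2 - u ^ 2 := by rw [hx]; field_simp
    -- Uses `2w(v - x) = u² - (v - w)²` and `2w(v + x) = (v + w)² - u²`.
    have hy : 0 ≤ v ^ 2 - x ^ 2 := by
      have h1 : 0 ≤ v - x := by
        have : 0 ≤ 2 * w * (v - x) := by nlinarith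
        exact nonneg_of_mul_nonneg_right this (by linarith)
      have h2 : 0 ≤ v + x := by
        have : 0 ≤ 2 * w * (v + x) := by nlinarith
        exact nonneg_of_mul_nonneg_right this (by linarith)
      nlinarith
    set y := Real.sqrt (v ^ 2 - x ^ 2)
    have hyy : y ^ 2 = v ^ 2 - x ^ 2 := Real.sq_sqrt hy
    let A : EuclideanSpace ℝ (Fin 2) := !₂[0, 0]
    let B : EuclideanSpace ℝ (Fin 2) := !₂[w, 0]
    let C : EuclideanSpace ℝ (Fin 2) := !₂[x, y]
    have hBC : dist B C = u := by
      rw [EuclideanSpace.dist_eq, Real.sqrt_eq_iff_mul_self_eq_of_pos (by linarith)]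
      simp [B, C, Fin.sum_univ_two, Real.dist_eq]
      nlinarith
    have hCA : dist C A = v := by
      rw [EuclideanSpace.dist_eq, Real.sqrt_eq_iff_mul_self_eq_of_pos (by linarith)]
      simp [A, C, Fin.sum_univ_two, Real.dist_eq]
      nlinarith
    have hAB : dist A B = w := by
      rw [EuclideanSpace.dist_eq, Real.sqrt_eq_iff_mul_self_eq_of_pos (by linarith)]
      simp [A, B, Fin.sum_univ_two, Real.dist_eq]
      ring
    refine ⟨⟨![A, B, C], ?_⟩, hBC, hCA, hAB⟩
    rw [affineIndependent_iff_not_collinear_set]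
    intro h
    rcases h.wbtw_or_wbtw_or_wbtw with h | h | h <;> rw [← dist_add_dist_eq_iff] at h
    · rw [hBC, hAB, dist_comm A C, hCA] at h
      linarith
    · rw [hBC, hCA, dist_comm B A, hAB] at h
      linarith
    · rw [hCA, hAB, dist_comm C B, hBC] at h
      linarith

/-- A permutation of `Fin 3` preserves or reverses the cyclic order, and `dist` is symmetric. -/
theorem sideLength_perm (T : EuclideanTriangle) (σ : Equiv.Perm (Fin 3)) (i : Fin 3) :
    dist (T.points (σ (i + 1))) (T.points (σ (i + 2))) = sideLength T (σ i) := by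
  have h : ∀ (σ : Equiv.Perm (Fin 3)) (i : Fin 3),
      (σ (i + 1) = σ i + 1 ∧ σ (i + 2) = σ i + 2) ∨
        (σ (i + 1) = σ i + 2 ∧ σ (i + 2) = σ i + 1) := by decide
  rcases h σ i with ⟨h1, h2⟩ | ⟨h1, h2⟩ <;> rw [h1, h2, sideLength]
  exact dist_comm _ _

theorem triangle_equiv_iff (T T' : EuclideanTriangle) :
    T ≈ T' ↔ ∃ (σ : Equiv.Perm (Fin 3)) (r : ℝ), r ≠ 0 ∧
      ∀ i, sideLength T (σ i) = r * sideLength T' i := by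
  change (∃ σ : Equiv.Perm (Fin 3), Similar (T.points ∘ σ) T'.points) ↔ _
  refine exists_congr fun σ => ?_
  rw [similar_iff_exists_pos_dist_eq]
  constructor
  · rintro ⟨r, hr, h⟩
    refine ⟨r, hr.ne', fun i => ?_⟩
    rw [← sideLength_perm]
    exact h _ _
  · rintro ⟨r, -, h⟩
    refine ⟨r, ?_, fun i j => ?_⟩
    · have := h 0 ▸ sideLength_pos T (σ 0)
      exact pos_of_mul_pos_left this (sideLength_pos T' 0).le
    · have hij : ∀ i j : Fin 3, i = j ∨
          (∃ k, i = k + 1 ∧ j = k + 2) ∨ ∃ k, i = k + 2 ∧ j = k + 1 := by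
        decide
      rcases hij i j with rfl | ⟨k, rfl, rfl⟩ | ⟨k, rfl, rfl⟩
      · simp
      · exact (sideLength_perm T σ k).trans (h k)
      · rw [dist_comm, dist_comm (T'.points _)]
        exact (sideLength_perm T σ k).trans (h k)

theorem signedMultiple_iff_abs (n n' : Fin 3 → ℝ) :
    SignedMultiple n n' ↔
      ∃ (σ : Equiv.Perm (Fin 3)) (r : ℝ), r ≠ 0 ∧ ∀ i, |n' (σ i)| = r * |n i| := by
  constructor
  · rintro ⟨τ, s, r, hs, hr, h⟩
    refine ⟨τ, |r|, abs_ne_zero.2 hr, fun i => ?_⟩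
    rw [h, abs_mul, abs_mul, (abs_eq zero_le_one).2 (hs i), one_mul]
  · rintro ⟨σ, r, hr, h⟩
    have : ∀ i, ∃ s : ℝ, (s = 1 ∨ s = -1) ∧ n' (σ i) = r * (s * n i) := by
      intro i
      have h1 : |n' (σ i)| = |r * n i| := by
        rw [← abs_abs, h, abs_mul, abs_mul, abs_abs]
      rcases abs_eq_abs.1 h1 with h2 | h2
      · exact ⟨1, Or.inl rfl, by rw [h2, one_mul]⟩
      · exact ⟨-1, Or.inr rfl, by rw [h2]; ring⟩
    choose s hs hn using this
    exact ⟨σ, s, r, hs, hr, hn⟩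

theorem triangle_equiv_iff_signedMultiple {n n' : Fin 3 → ℝ} {T T' : EuclideanTriangle}
    (hT : sideLength T = fun i => |n i|) (hT' : sideLength T' = fun i => |n' i|) :
    T' ≈ T ↔ SignedMultiple n n' := by
  rw [triangle_equiv_iff, signedMultiple_iff_abs, hT, hT']

/-! ### Isometry classes and similarity classes. -/

theorem plane_eq (n : Fin 3 → ℝ) (d : ℝ) : plane (n 0) (n 1) (n 2) d = {p | n ⬝ᵥ p = d} :=
  Set.ext (mem_plane_iff_dotProduct n d)

theorem StrictTriangle.nonempty_isometryEquiv_iff {n n' : Fin 3 → ℝ} (h : StrictTriangle n)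
    (hn' : n' ≠ 0) (d d' : ℝ) :
    Nonempty ({p | n ⬝ᵥ p = d} ≃ᵢ {p | n' ⬝ᵥ p = d'}) ↔ SignedMultiple n n' :=
  ⟨fun ⟨e⟩ => h.signedMultiple hn' e,
    fun hs => hs.nonempty_isometryEquiv (fun h0 => h.ne_zero 0 (congrFun h0 0)) d d'⟩

theorem vec_ne_zero {a b c : ℝ} (h : a ≠ 0 ∨ b ≠ 0 ∨ c ≠ 0) : ![a, b, c] ≠ 0 := by
  intro h0
  have h1 := congrFun h0 0
  have h2 := congrFun h0 1
  have h3 := congrFun h0 2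
  simp at h1 h2 h3
  simp_all

theorem exists_coeffs (P : TriangularPlane) : ∃ (n : Fin 3 → ℝ) (d : ℝ) (T : EuclideanTriangle),
    P.1 = {p | n ⬝ᵥ p = d} ∧ sideLength T = fun i => |n i| := by
  obtain ⟨a, b, c, d, ⟨T, hT⟩, hP⟩ := P.2
  refine ⟨![a, b, c], d, T, ?_, (hasSideLengths_iff T fun i => |![a, b, c] i|).1 hT⟩
  rw [hP]
  exact plane_eq ![a, b, c] d

theorem strictTriangle_of_sideLength {n : Fin 3 → ℝ} {T : EuclideanTriangle}
    (h : sideLength T = fun i => |n i|) : StrictTriangle n :=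
  (areTriangleSides_iff n).1 ⟨T, (hasSideLengths_iff T fun i => |n i|).2 h⟩

/-- The two directions make `Φ` well defined and injective. Taking `P = Q` shows that the choice of
equation and triangle does not matter. -/
theorem triangularPlane_equiv_iff {P Q : TriangularPlane} {n n' : Fin 3 → ℝ} {d d' : ℝ}
    {T T' : EuclideanTriangle} (hP : P.1 = {p | n ⬝ᵥ p = d}) (hQ : Q.1 = {p | n' ⬝ᵥ p = d'})
    (hT : sideLength T = fun i => |n i|) (hT' : sideLength T' = fun i => |n' i|) :
    P ≈ Q ↔ T ≈ T' := by
  have h := strictTriangle_of_sideLength hT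
  have h' := strictTriangle_of_sideLength hT'
  have hc : T ≈ T' ↔ T' ≈ T := ⟨Setoid.symm, Setoid.symm⟩
  rw [hc, triangle_equiv_iff_signedMultiple hT hT',
    ← h.nonempty_isometryEquiv_iff (fun h0 => h'.ne_zero 0 (congrFun h0 0)) d d', ← hP, ← hQ]
  rfl

end MaxMetric

open MaxMetric

theorem mainTheorem1 :
    (∀ a b c d : ℝ, (a ≠ 0 ∨ b ≠ 0 ∨ c ≠ 0) →
      (¬ MaxMetric.AreTriangleSides |a| |b| |c| →
        Nonempty (MaxMetric.plane a b c d ≃ᵢ (Fin 2 → ℝ)) ∧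
        ∀ a' b' c' d' : ℝ, (a' ≠ 0 ∨ b' ≠ 0 ∨ c' ≠ 0) →
          (Nonempty (MaxMetric.plane a b c d ≃ᵢ MaxMetric.plane a' b' c' d') ↔
            ¬ MaxMetric.AreTriangleSides |a'| |b'| |c'|)) ∧
      (MaxMetric.AreTriangleSides |a| |b| |c| →
        ∀ Q : Set (Fin 3 → ℝ), MaxMetric.IsPlane Q →
          (Nonempty (MaxMetric.plane a b c d ≃ᵢ Q) ↔
            ∃ (w : Fin 3 → (Fin 3 → ℝ) → ℝ) (D : ℝ), MaxMetric.IsSignedCoords w ∧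
              Q = {p | a * w 0 p + b * w 1 p + c * w 2 p = D}))) ∧
    (∃ Φ : Quotient MaxMetric.planeIsometry ≃ Quotient MaxMetric.triangleSimilarity,
      ∀ (P : MaxMetric.TriangularPlane) (a b c d : ℝ) (T : MaxMetric.EuclideanTriangle),
        P.1 = MaxMetric.plane a b c d → MaxMetric.HasSideLengths T |a| |b| |c| →
          Φ (Quotient.mk MaxMetric.planeIsometry P) =
            Quotient.mk MaxMetric.triangleSimilarity T) := by
  have hplane : ∀ a b c d, plane a b c d = {p | ![a, b, c] ⬝ᵥ p = d} :=
    fun a b c d => plane_eq ![a, b, c] d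
  have hsides : ∀ a b c : ℝ, AreTriangleSides |a| |b| |c| ↔ StrictTriangle ![a, b, c] :=
    fun a b c => areTriangleSides_iff ![a, b, c]
  refine ⟨fun a b c d habc => ⟨fun htri => ?_, fun htri => ?_⟩, ?_⟩
  · rw [hsides] at htri
    rw [hplane a b c d]
    obtain ⟨e⟩ := nonempty_isometryEquiv_of_dominant (vec_ne_zero habc) d htri
    refine ⟨⟨e⟩, fun a' b' c' d' habc' => ?_⟩
    rw [hplane a' b' c' d', hsides]
    refine ⟨fun ⟨f⟩ h => htri ?_, fun htri' => ?_⟩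
    -- The isometry is inverted because rigidity needs the triangular plane as its source.
    · exact (h.signedMultiple (vec_ne_zero habc) f.symm).strictTriangle h
    · obtain ⟨e'⟩ := nonempty_isometryEquiv_of_dominant (vec_ne_zero habc') d' htri'
      exact ⟨e.trans e'.symm⟩
  · rw [hsides] at htri
    rintro Q ⟨a', b', c', d', habc', rfl⟩
    rw [hplane a b c d, hplane a' b' c' d']
    constructor
    · rintro ⟨e⟩
      exact (htri.signedMultiple (vec_ne_zero habc') e).exists_signedCoords d'
    · rintro ⟨w, D, hw, hD⟩
      rw [hD]
      exact nonempty_isometryEquiv_of_signedCoords (vec_ne_zero habc) d D hw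
  · choose n d T hP hT using exists_coeffs
    refine ⟨Equiv.ofBijective (Quotient.map T fun P Q h =>
      (triangularPlane_equiv_iff (hP P) (hP Q) (hT P) (hT Q)).1 h) ⟨?_, ?_⟩, ?_⟩
    · rintro ⟨P⟩ ⟨Q⟩ h
      exact Quotient.sound
        ((triangularPlane_equiv_iff (hP P) (hP Q) (hT P) (hT Q)).2 (Quotient.exact h))
    · rintro ⟨S⟩
      have hS : sideLength S = fun i => |sideLength S i| :=
        funext fun i => (abs_of_pos (sideLength_pos S i)).symm
      -- The chosen triangle `T P` need not be `S`, but both belong to equations of `P`, so they are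
      -- similar.
      let P : TriangularPlane := ⟨plane (sideLength S 0) (sideLength S 1) (sideLength S 2) 0,
        _, _, _, _, (areTriangleSides_iff _).2 (strictTriangle_of_sideLength hS), rfl⟩
      exact ⟨Quotient.mk _ P, Quotient.sound ((triangularPlane_equiv_iff (hP P)
        (plane_eq (sideLength S) 0) (hT P) hS).1 (Setoid.refl P))⟩
    · intro P a b c d' S hPS hS
      exact Quotient.sound ((triangularPlane_equiv_iff (hP P) (hPS.trans (hplane a b c d')) (hT P)
        ((hasSideLengths_iff S fun i => |![a, b, c] i|).1 hS)).1 (Setoid.refl P))
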